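/- Let $n\ge 1$, and let $T$ be the complete binary tree with $n$ levels: a root with two children, each of these with two children, and so on, so that there are $2^{j-1}$ vertices on the $j$-th level for $1\le j\le n$. Attach to the root of $T$ an additional leaf, labelled $0$. Let $L_0$ be the matrix obtained from the Laplacian matrix of the resulting tree by deleting the row and the column indexed by $0$, and let $$\mathcal{C}=\{x\in\mathbb{R}^{2^n-1} : L_0\,x\ge 0\},$$ where the inequality is understood componentwise. For $m\in\mathcal{C}\cap\mathbb{Z}^{2^n-1}$ let $|m|$ be the sum of the entries of $m$. Then $|m|\ge 0$ for all $m\in\mathcal{C}\cap\mathbb{Z}^{2^n-1}$, for every $N$ only finitely many of these $m$ satisfy $|m|=N$, and the formal power series $$\sigma_{\mathcal{C}}(q)=\sum_{m\in\mathcal{C}\cap\mathbb{Z}^{2^n-1}}q^{|m|}$$ is given by $$\sigma_{\mathcal{C}}(q)=\frac{1}{\prod_{j=1}^{n}\left(1-q^{\,j(2^{n-j+1}-1)+\sum_{i=1}^{j-1}(j-i)2^{n-(j-i)}}\right)^{2^{j-1}}}=\frac{1}{\prod_{j=1}^{n}\left(1-q^{\,2^{n-j+1}(2^{j}-1)-j}\right)^{2^{j-1}}}.$$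 -/

import Mathlib

section LaplacianCone

variable {V : Type*} [Fintype V] [DecidableEq V]

/-- The minor of the Laplacian matrix of `G` at the vertex `r`: the row and the column indexed by
`r` are deleted. -/
def laplacianMinor (G : SimpleGraph V) [DecidableRel G.Adj] (r : V) :
    Matrix {v : V // v ≠ r} {v : V // v ≠ r} ℝ :=
  (G.lapMatrix ℝ).submatrix Subtype.val Subtype.val

/-- The cone `{x : A x ≥ 0}` (componentwise inequality) of a square matrix `A`. -/
def matrixCone (A : Matrix V V ℝ) : Set (V → ℝ) :=
  {x | ∀ v, 0 ≤ (A.mulVec x) v}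

/-- The integer points `m` of the set `C` with `|m| = ∑ v, m v` equal to `N`. -/
def integerPointsOfSize (C : Set (V → ℝ)) (N : ℤ) : Set (V → ℤ) :=
  {m | (fun v => (m v : ℝ)) ∈ C ∧ ∑ v, m v = N}

/-- The formal sum `∑ q ^ |m|` over the integer points `m` of `C` makes sense as a power series
in `q`: no `m` has `|m| < 0`, and each power of `q` occurs only finitely often. -/
def HasIntegerPointSeries (C : Set (V → ℝ)) : Prop :=
  (∀ N : ℤ, N < 0 → integerPointsOfSize C N = ∅) ∧
    ∀ N : ℤ, (integerPointsOfSize C N).Finite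

/-- The specialized integer point transform `σ_C(q) = ∑ q ^ |m|`, the sum being over the integer
points `m` of `C`: the coefficient of `q ^ N` is the number of integer points `m` of `C` with
`|m| = N`. It is meant for those `C` that satisfy `HasIntegerPointSeries C`. -/
noncomputable def integerPointSeries (C : Set (V → ℝ)) : PowerSeries ℚ :=
  PowerSeries.mk fun N : ℕ => ((integerPointsOfSize C (N : ℤ)).ncard : ℚ)

end LaplacianCone

/-- The (complete) binary tree with `n` levels, together with an extra leaf attached to its root.
The vertices are `0, 1, …, 2 ^ n - 1`, where `0` is the extra leaf and `1` is the root; the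
children of the vertex `i ≥ 1` are `2 i` and `2 i + 1`. Thus every vertex `i ≠ 0` is joined to
`⌊i / 2⌋`, and the vertices at distance `j ≥ 1` from `0` (the level `j`) are
`2 ^ (j - 1), …, 2 ^ j - 1`. -/
def leafedBinaryTree (n : ℕ) : SimpleGraph (Fin (2 ^ n)) where
  Adj i j := i ≠ j ∧ ((j : ℕ) = (i : ℕ) / 2 ∨ (i : ℕ) = (j : ℕ) / 2)
  symm := ⟨fun _ _ h => ⟨h.1.symm, h.2.symm⟩⟩
  loopless := ⟨fun _ h => h.1 rfl⟩

instance (n : ℕ) : DecidableRel (leafedBinaryTree n).Adj := fun i j =>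
  inferInstanceAs (Decidable (i ≠ j ∧ ((j : ℕ) = (i : ℕ) / 2 ∨ (i : ℕ) = (j : ℕ) / 2)))

/-- The cone of (real) compositions constrained by the Laplacian minor of the binary tree with `n`
levels, the minor being taken at the extra leaf `0` attached to the root. -/
def binaryTreeCone (n : ℕ) : Set ({v : Fin (2 ^ n) // v ≠ 0} → ℝ) :=
  matrixCone (laplacianMinor (leafedBinaryTree n) 0)

/-- The power series `∑ X ^ k` over the multiples `k` of `d`. -/
noncomputable def multiplesSeries (d : ℕ) : PowerSeries ℚ :=
  PowerSeries.mk fun k => if d ∣ k then 1 else 0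

theorem multiplesSeries_mul_one_sub {d : ℕ} (hd : 0 < d) :
    multiplesSeries d * (1 - PowerSeries.X ^ d) = 1 := by
  ext k
  rw [mul_sub, mul_one, map_sub, PowerSeries.coeff_mul_X_pow']
  simp only [multiplesSeries, PowerSeries.coeff_mk, PowerSeries.coeff_one]
  by_cases h : d ≤ k
  · have h0 : k ≠ 0 := by omega
    simp [h, h0, Nat.dvd_sub_iff_left h dvd_rfl]
  · rcases Nat.eq_zero_or_pos k with rfl | h0
    · simp [h]
    · have : ¬ d ∣ k := fun hdk => h (Nat.le_of_dvd h0 hdk)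
      simp [h, this, h0.ne']

theorem coeff_prod_multiplesSeries {V : Type*} [Fintype V] [DecidableEq V] (c : V → ℕ) (N : ℕ) :
    PowerSeries.coeff N (∏ v, multiplesSeries (c v)) =
      (((Finset.finsuppAntidiag Finset.univ N).filter fun l : V →₀ ℕ => ∀ v, c v ∣ l v).card
        : ℚ) := by
  classical
  rw [PowerSeries.coeff_prod, Finset.card_filter, Nat.cast_sum]
  refine Finset.sum_congr rfl fun l _ => ?_
  simp only [multiplesSeries, PowerSeries.coeff_mk]
  rw [Finset.prod_ite_zero]
  simp

theorem mem_integerPointsOfSize_matrixCone {V : Type*} [Fintype V] (A : Matrix V V ℤ) (N : ℤ) (m : V → ℤ) :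
    m ∈ integerPointsOfSize (matrixCone (A.map (Int.cast : ℤ → ℝ))) N ↔
      (∀ v, 0 ≤ (A.mulVec m) v) ∧ ∑ v, m v = N := by
  have h : ∀ v, ((A.map (Int.cast : ℤ → ℝ)).mulVec fun v => (m v : ℝ)) v =
      (((A.mulVec m) v : ℤ) : ℝ) := by
    intro v
    simp [Matrix.mulVec, dotProduct]
  simp only [integerPointsOfSize, matrixCone, Set.mem_ofPred_eq, h, Int.cast_nonneg_iff]

theorem sum_eq_of_vecMul_eq_one {V : Type*} [Fintype V] {A : Matrix V V ℤ} {c : V → ℤ} (hc : Matrix.vecMul c A = 1)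
    (m : V → ℤ) : ∑ v, m v = ∑ v, c v * (A.mulVec m) v := by
  have := Matrix.dotProduct_mulVec c A m
  rw [hc, one_dotProduct] at this
  exact this.symm

section UnimodularCone

variable {V : Type*} [Fintype V] [DecidableEq V]

/-- The integer points of size `N` of a unimodular cone, in terms of the vectors `A m`, rescaled
by the positive weights `c`. -/
theorem integerPointsOfSize_eq_image {A : Matrix V V ℤ} (hA : IsUnit A.det) {c : V → ℕ}
    (hc0 : ∀ v, 0 < c v) (hc : Matrix.vecMul (fun v => (c v : ℤ)) A = 1) (N : ℕ) :
    integerPointsOfSize (matrixCone (A.map (Int.cast : ℤ → ℝ))) N =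
      (fun l : V →₀ ℕ => A⁻¹.mulVec fun v => ((l v / c v : ℕ) : ℤ)) ''
        ((Finset.finsuppAntidiag Finset.univ N).filter fun l : V →₀ ℕ => ∀ v, c v ∣ l v) := by
  ext m
  rw [mem_integerPointsOfSize_matrixCone, sum_eq_of_vecMul_eq_one hc]
  simp only [Finset.coe_filter, Set.mem_image, Set.mem_ofPred_eq, Finset.mem_finsuppAntidiag]
  constructor
  · rintro ⟨h0, hN⟩
    refine ⟨Finsupp.equivFunOnFinite.symm fun v => c v * ((A.mulVec m) v).toNat, ⟨⟨?_, ?_⟩, ?_⟩, ?_⟩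
    · have : ((∑ v, c v * ((A.mulVec m) v).toNat : ℕ) : ℤ) = N := by
        rw [← hN]
        push_cast
        exact Finset.sum_congr rfl fun v _ => by rw [Int.toNat_of_nonneg (h0 v)]
      exact_mod_cast this
    · simp
    · simp
    · have : (fun v => (((Finsupp.equivFunOnFinite.symm
          fun v => c v * ((A.mulVec m) v).toNat) v / c v : ℕ) : ℤ)) = A.mulVec m := by
        ext v
        simp only [Finsupp.equivFunOnFinite_symm_apply_apply]
        rw [Nat.mul_div_cancel_left _ (hc0 v), Int.toNat_of_nonneg (h0 v)]
      rw [this, Matrix.mulVec_mulVec, Matrix.nonsing_inv_mul _ hA, Matrix.one_mulVec]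
  · rintro ⟨l, ⟨⟨hl, -⟩, hd⟩, rfl⟩
    simp only [Matrix.mulVec_mulVec, Matrix.mul_nonsing_inv _ hA, Matrix.one_mulVec]
    refine ⟨fun v => Int.natCast_nonneg _, ?_⟩
    rw [← hl]
    push_cast
    refine Finset.sum_congr rfl fun v _ => ?_
    exact_mod_cast Nat.mul_div_cancel' (hd v)

theorem ncard_integerPointsOfSize {A : Matrix V V ℤ} (hA : IsUnit A.det) {c : V → ℕ}
    (hc0 : ∀ v, 0 < c v) (hc : Matrix.vecMul (fun v => (c v : ℤ)) A = 1) (N : ℕ) :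
    (integerPointsOfSize (matrixCone (A.map (Int.cast : ℤ → ℝ))) N).ncard =
      ((Finset.finsuppAntidiag Finset.univ N).filter fun l : V →₀ ℕ => ∀ v, c v ∣ l v).card := by
  rw [integerPointsOfSize_eq_image hA hc0 hc, Set.InjOn.ncard_image, Set.ncard_coe_finset]
  intro l hl l' hl' h
  have hd := (Finset.mem_filter.mp hl).2
  have hd' := (Finset.mem_filter.mp hl').2
  have h1 := congrArg A.mulVec h
  simp only [Matrix.mulVec_mulVec, Matrix.mul_nonsing_inv _ hA, Matrix.one_mulVec] at h1
  ext v
  have h2 : l v / c v = l' v / c v := by exact_mod_cast congrFun h1 v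
  rw [← Nat.mul_div_cancel' (hd v), h2, Nat.mul_div_cancel' (hd' v)]

theorem hasIntegerPointSeries_matrixCone {A : Matrix V V ℤ} (hA : IsUnit A.det) {c : V → ℕ}
    (hc0 : ∀ v, 0 < c v) (hc : Matrix.vecMul (fun v => (c v : ℤ)) A = 1) :
    HasIntegerPointSeries (matrixCone (A.map (Int.cast : ℤ → ℝ))) := by
  have hneg : ∀ N : ℤ, N < 0 →
      integerPointsOfSize (matrixCone (A.map (Int.cast : ℤ → ℝ))) N = ∅ := by
    intro N hN
    rw [Set.eq_empty_iff_forall_notMem]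
    intro m hm
    rw [mem_integerPointsOfSize_matrixCone, sum_eq_of_vecMul_eq_one hc] at hm
    have : 0 ≤ ∑ v, (c v : ℤ) * (A.mulVec m) v :=
      Finset.sum_nonneg fun v _ => mul_nonneg (Int.natCast_nonneg _) (hm.1 v)
    omega
  refine ⟨hneg, fun N => ?_⟩
  rcases lt_or_ge N 0 with hN | hN
  · rw [hneg N hN]
    exact Set.finite_empty
  · lift N to ℕ using hN
    rw [integerPointsOfSize_eq_image hA hc0 hc]
    exact (Finset.finite_toSet _).image _

theorem integerPointSeries_matrixCone {A : Matrix V V ℤ} (hA : IsUnit A.det) {c : V → ℕ}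
    (hc0 : ∀ v, 0 < c v) (hc : Matrix.vecMul (fun v => (c v : ℤ)) A = 1) :
    integerPointSeries (matrixCone (A.map (Int.cast : ℤ → ℝ))) =
      (∏ v, (1 - PowerSeries.X ^ c v))⁻¹ := by
  have h1 : integerPointSeries (matrixCone (A.map (Int.cast : ℤ → ℝ))) =
      ∏ v, multiplesSeries (c v) := by
    ext N
    rw [coeff_prod_multiplesSeries, integerPointSeries, PowerSeries.coeff_mk,
      ncard_integerPointsOfSize hA hc0 hc]
  rw [h1, PowerSeries.eq_inv_iff_mul_eq_one, ← Finset.prod_mul_distrib]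
  · exact Finset.prod_eq_one fun v _ => multiplesSeries_mul_one_sub (hc0 v)
  · rw [map_prod, Finset.prod_ne_zero_iff]
    intro v _
    simp [(hc0 v).ne']

end UnimodularCone

theorem Nat.size_eq_size_div_two_add_one {v : ℕ} (hv : v ≠ 0) :
    Nat.size v = Nat.size (v / 2) + 1 := by
  have h := Nat.size_bit (b := Nat.bodd v) (n := Nat.div2 v) (by rwa [Nat.bit_bodd_div2])
  rwa [Nat.bit_bodd_div2, Nat.div2_val] at h

theorem Nat.size_eq_of_mem_Ico {n v : ℕ} (h1 : 2 ^ n ≤ v) (h2 : v < 2 ^ (n + 1)) :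
    Nat.size v = n + 1 :=
  le_antisymm (Nat.size_le.mpr h2) (Nat.lt_size.mpr h1)

@[to_additive]
theorem prod_fin_ne_zero {M : Type*} [CommMonoid M] (n : ℕ) [NeZero n] (F : ℕ → M) :
    ∏ v : {v : Fin n // v ≠ 0}, F (v : Fin n) = ∏ i ∈ Finset.Ico 1 n, F i := by
  refine Finset.prod_bij (fun v _ => ((v : Fin n) : ℕ)) ?_ ?_ ?_ ?_
  · intro v _
    have : ((v : Fin n) : ℕ) ≠ 0 := fun h => v.2 (Fin.ext (by simpa using h))
    exact Finset.mem_Ico.mpr ⟨Nat.one_le_iff_ne_zero.mpr this, v.1.2⟩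
  · intro v _ w _ h
    exact Subtype.ext (Fin.ext h)
  · intro i hi
    obtain ⟨h1, h2⟩ := Finset.mem_Ico.mp hi
    refine ⟨⟨⟨i, h2⟩, fun h => ?_⟩, Finset.mem_univ _, rfl⟩
    have := congrArg Fin.val h
    simp at this
    omega
  · intro v _
    rfl

theorem prod_Ico_size {M : Type*} [CommMonoid M] (n : ℕ) (F : ℕ → M) :
    ∏ i ∈ Finset.Ico 1 (2 ^ n), F (Nat.size i) = ∏ j ∈ Finset.Icc 1 n, F j ^ 2 ^ (j - 1) := by
  induction n with
  | zero => simp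
  | succ n ih =>
    rw [← Finset.prod_Ico_consecutive _ Nat.one_le_two_pow
      (Nat.pow_le_pow_right two_pos (Nat.le_succ n)), ih, Finset.prod_Icc_succ_top (by omega)]
    congr 1
    rw [Finset.prod_congr rfl (g := fun _ => F (n + 1)), Finset.prod_const, Nat.card_Ico]
    · congr 1
      rw [pow_succ]
      simp
      omega
    · intro i hi
      obtain ⟨h1, h2⟩ := Finset.mem_Ico.mp hi
      rw [Nat.size_eq_of_mem_Ico h1 h2]

/-- The column sum of the inverse of the Laplacian minor of the leafed binary tree with `n`
levels, in a column indexed by a vertex of level `j`. -/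
def binaryTreeWeight (n j : ℕ) : ℕ := 2 ^ (n - j + 1) * (2 ^ j - 1) - j

theorem binaryTreeWeight_add {n j : ℕ} (hj : j ≤ n) :
    binaryTreeWeight n j + 2 ^ (n - j + 1) + j = 2 ^ (n + 1) := by
  obtain ⟨k, rfl⟩ := Nat.exists_eq_add_of_le hj
  have h1 : j + 1 ≤ 2 ^ j := Nat.lt_two_pow_self
  obtain ⟨t, ht⟩ := Nat.exists_eq_add_of_le h1
  have h2 : 1 ≤ 2 ^ (k + 1) := Nat.one_le_two_pow
  have h3 : j ≤ 2 ^ (k + 1) * (j + t) := by nlinarith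
  have h4 : 2 ^ (j + k + 1) = 2 ^ (k + 1) * (2 ^ j) := by ring
  rw [binaryTreeWeight, show j + k - j + 1 = k + 1 by omega, h4, ht,
    show j + 1 + t - 1 = j + t by omega]
  zify [h3]
  ring

theorem binaryTreeWeight_pos {n j : ℕ} (h1 : 1 ≤ j) (hj : j ≤ n) : 0 < binaryTreeWeight n j := by
  have h := binaryTreeWeight_add hj
  obtain ⟨k, rfl⟩ := Nat.exists_eq_add_of_le hj
  rw [show j + k - j + 1 = k + 1 by omega, show j + k + 1 = j + (k + 1) by omega,
    pow_add 2 j (k + 1)] at h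
  have h2 : j + 1 ≤ 2 ^ j := Nat.lt_two_pow_self
  have h3 : 2 ≤ 2 ^ (k + 1) := Nat.le_self_pow (by omega) 2
  nlinarith

theorem sum_range_mul_two_pow_sub {n j : ℕ} (hj : j ≤ n + 1) :
    ∑ k ∈ Finset.range j, k * 2 ^ (n - k) + (j + 1) * 2 ^ (n + 1 - j) = 2 ^ (n + 1) := by
  induction j with
  | zero => simp
  | succ j ih =>
    have h := ih (by omega)
    obtain ⟨k, rfl⟩ := Nat.exists_eq_add_of_le (Nat.le_of_succ_le_succ hj)
    rw [Finset.sum_range_succ, ← h]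
    rw [show j + k + 1 - j = k + 1 by omega, show j + k - j = k by omega,
      show j + k + 1 - (j + 1) = k by omega]
    ring

theorem binaryTreeWeight_eq_sum {n j : ℕ} (h1 : 1 ≤ j) (hj : j ≤ n) :
    j * (2 ^ (n - j + 1) - 1) + ∑ i ∈ Finset.Icc 1 (j - 1), (j - i) * 2 ^ (n - (j - i)) =
      binaryTreeWeight n j := by
  have hs : ∑ i ∈ Finset.Icc 1 (j - 1), (j - i) * 2 ^ (n - (j - i)) =
      ∑ k ∈ Finset.range j, k * 2 ^ (n - k) := by
    rw [Finset.range_eq_Ico, Finset.sum_eq_sum_Ico_succ_bot (by omega)]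
    simp only [zero_mul, zero_add]
    refine Finset.sum_nbij' (fun i => j - i) (fun i => j - i) ?_ ?_ ?_ ?_ ?_
    · intro i hi
      simp only [Finset.mem_Icc, Finset.mem_Ico] at *
      omega
    · intro i hi
      simp only [Finset.mem_Icc, Finset.mem_Ico] at *
      omega
    · intro i hi
      simp only [Finset.mem_Icc] at hi
      omega
    · intro i hi
      simp only [Finset.mem_Ico] at hi
      omega
    · intro i _
      rfl
  have h2 := binaryTreeWeight_add hj
  have h3 := sum_range_mul_two_pow_sub (n := n) (j := j) (by omega)
  rw [show n + 1 - j = n - j + 1 by omega] at h3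
  have h4 : 1 ≤ 2 ^ (n - j + 1) := Nat.one_le_two_pow
  rw [hs]
  zify [h4] at *
  linarith

/-- The matrix of the map which sends a function on the vertices `≠ 0` of the leafed binary tree
to its increments along the edges from the parents, the value at the leaf `0` being `0`. -/
def parentMatrix (n : ℕ) :
    Matrix {v : Fin (2 ^ n) // v ≠ 0} {v : Fin (2 ^ n) // v ≠ 0} ℤ :=
  Matrix.of fun w u =>
    (if w = u then 1 else 0) - (if ((w : Fin (2 ^ n)) : ℕ) / 2 = (u : Fin (2 ^ n)) then 1 else 0)

theorem Fin.val_pos_of_subtype_ne_zero {n : ℕ} [NeZero n] (v : {v : Fin n // v ≠ 0}) :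
    0 < ((v : Fin n) : ℕ) :=
  Nat.pos_of_ne_zero fun h => v.2 (Fin.ext (by simpa using h))

theorem det_parentMatrix (n : ℕ) : (parentMatrix n).det = 1 := by
  rw [Matrix.det_of_isLowerTriangular]
  · refine Finset.prod_eq_one fun v _ => ?_
    have := Fin.val_pos_of_subtype_ne_zero v
    have h : ((v : Fin (2 ^ n)) : ℕ) / 2 ≠ (v : Fin (2 ^ n)) := by omega
    simp [parentMatrix, h]
  · intro w u h
    have h1 : w < u := h
    have h2 : ((w : Fin (2 ^ n)) : ℕ) < (u : Fin (2 ^ n)) := h1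
    have h3 : ((w : Fin (2 ^ n)) : ℕ) / 2 ≠ (u : Fin (2 ^ n)) := by omega
    simp [parentMatrix, h1.ne, h3]

theorem degree_leafedBinaryTree (n : ℕ) (u : {v : Fin (2 ^ n) // v ≠ 0}) :
    (leafedBinaryTree n).degree u = (Finset.univ.filter fun w : {v : Fin (2 ^ n) // v ≠ 0} =>
      ((w : Fin (2 ^ n)) : ℕ) / 2 = (u : Fin (2 ^ n))).card + 1 := by
  have hu := Fin.val_pos_of_subtype_ne_zero u
  have h : (leafedBinaryTree n).neighborFinset u =
      insert (⟨((u : Fin (2 ^ n)) : ℕ) / 2, by omega⟩ : Fin (2 ^ n))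
        ((Finset.univ.filter fun w : {v : Fin (2 ^ n) // v ≠ 0} =>
          ((w : Fin (2 ^ n)) : ℕ) / 2 = (u : Fin (2 ^ n))).map (Function.Embedding.subtype _)) := by
    ext w
    rw [SimpleGraph.mem_neighborFinset]
    simp only [leafedBinaryTree, Finset.mem_insert,
      Finset.mem_map, Finset.mem_filter, Finset.mem_univ, true_and, Fin.ext_iff, ne_eq,
      Function.Embedding.subtype_apply, Subtype.exists]
    constructor
    · rintro ⟨h1, h2 | h2⟩
      · exact Or.inl h2
      · refine Or.inr ⟨w, fun h0 => ?_, h2.symm, rfl⟩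
        have h3 : (w : ℕ) = 0 := by simp [h0]
        omega
    · rintro (h1 | ⟨a, _, h1, h2⟩)
      · exact ⟨by omega, Or.inl h1⟩
      · exact ⟨by omega, Or.inr (by omega)⟩
  rw [SimpleGraph.degree, h, Finset.card_insert_of_notMem, Finset.card_map]
  simp only [Finset.mem_map, Finset.mem_filter, Finset.mem_univ, true_and, Fin.ext_iff,
    Function.Embedding.subtype_apply, not_exists, not_and]
  intro a h1 h2
  omega

theorem laplacianMinor_leafedBinaryTree (n : ℕ) :
    laplacianMinor (leafedBinaryTree n) 0 =
      ((parentMatrix n).transpose * parentMatrix n).map (Int.cast : ℤ → ℝ) := by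
  ext u v
  have hu := Fin.val_pos_of_subtype_ne_zero u
  have hv := Fin.val_pos_of_subtype_ne_zero v
  have hsum : ((parentMatrix n).transpose * parentMatrix n) u v =
      (if u = v then 1 else 0) -
        (if ((u : Fin (2 ^ n)) : ℕ) / 2 = (v : Fin (2 ^ n)) then 1 else 0) -
        (if ((v : Fin (2 ^ n)) : ℕ) / 2 = (u : Fin (2 ^ n)) then 1 else 0) +
        (if u = v then (((Finset.univ.filter fun w : {v : Fin (2 ^ n) // v ≠ 0} =>
          ((w : Fin (2 ^ n)) : ℕ) / 2 = (u : Fin (2 ^ n))).card : ℕ) : ℤ) else 0) := by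
    have h4 : (∑ w : {v : Fin (2 ^ n) // v ≠ 0},
        (if ((w : Fin (2 ^ n)) : ℕ) / 2 = (u : Fin (2 ^ n)) then (1 : ℤ) else 0) *
        (if ((w : Fin (2 ^ n)) : ℕ) / 2 = (v : Fin (2 ^ n)) then (1 : ℤ) else 0)) =
        (if u = v then (((Finset.univ.filter fun w : {v : Fin (2 ^ n) // v ≠ 0} =>
          ((w : Fin (2 ^ n)) : ℕ) / 2 = (u : Fin (2 ^ n))).card : ℕ) : ℤ) else 0) := by
      split_ifs with h
      · subst h
        rw [Finset.card_filter, Nat.cast_sum]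
        refine Finset.sum_congr rfl fun w _ => ?_
        split_ifs <;> simp
      · refine Finset.sum_eq_zero fun w _ => ?_
        have : ((u : Fin (2 ^ n)) : ℕ) ≠ (v : Fin (2 ^ n)) :=
          fun h' => h (Subtype.ext (Fin.ext h'))
        split_ifs <;> omega
    have h1 : (∑ w : {v : Fin (2 ^ n) // v ≠ 0},
        (if w = u then (1 : ℤ) else 0) * (if w = v then (1 : ℤ) else 0)) =
        if u = v then 1 else 0 := by
      simp only [ite_mul, one_mul, zero_mul, Finset.sum_ite_eq', Finset.mem_univ, if_true]
    have h2 : (∑ w : {v : Fin (2 ^ n) // v ≠ 0}, (if w = u then (1 : ℤ) else 0) *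
        (if ((w : Fin (2 ^ n)) : ℕ) / 2 = (v : Fin (2 ^ n)) then (1 : ℤ) else 0)) =
        if ((u : Fin (2 ^ n)) : ℕ) / 2 = (v : Fin (2 ^ n)) then 1 else 0 := by
      simp only [ite_mul, one_mul, zero_mul, Finset.sum_ite_eq', Finset.mem_univ, if_true]
    have h3 : (∑ w : {v : Fin (2 ^ n) // v ≠ 0},
        (if ((w : Fin (2 ^ n)) : ℕ) / 2 = (u : Fin (2 ^ n)) then (1 : ℤ) else 0) *
        (if w = v then (1 : ℤ) else 0)) =
        if ((v : Fin (2 ^ n)) : ℕ) / 2 = (u : Fin (2 ^ n)) then 1 else 0 := by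
      simp only [mul_ite, mul_one, mul_zero, Finset.sum_ite_eq', Finset.mem_univ, if_true]
    simp only [Matrix.mul_apply, Matrix.transpose_apply, parentMatrix, Matrix.of_apply, sub_mul,
      mul_sub, Finset.sum_sub_distrib, h1, h2, h3, h4]
    ring
  rw [Matrix.map_apply, hsum, laplacianMinor, Matrix.submatrix_apply, SimpleGraph.lapMatrix,
    Matrix.sub_apply, SimpleGraph.degMatrix, SimpleGraph.adjMatrix_apply, Matrix.diagonal_apply,
    degree_leafedBinaryTree]
  by_cases h : u = v
  · subst h
    have : ((u : Fin (2 ^ n)) : ℕ) / 2 ≠ (u : Fin (2 ^ n)) := by omega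
    simp [this]
    ring
  · have h0 : (u : Fin (2 ^ n)) ≠ v := fun h' => h (Subtype.ext h')
    have h1 : ((u : Fin (2 ^ n)) : ℕ) ≠ (v : Fin (2 ^ n)) := fun h' => h0 (Fin.ext h')
    simp only [h0, h, if_false, leafedBinaryTree, ne_eq, not_false_eq_true, true_and]
    split_ifs <;> first | omega | simp

theorem parentMatrix_mulVec (n : ℕ) (f : ℕ → ℤ) (hf : f 0 = 0)
    (w : {v : Fin (2 ^ n) // v ≠ 0}) :
    (parentMatrix n).mulVec (fun v => f (v : Fin (2 ^ n))) w =
      f (w : Fin (2 ^ n)) - f (((w : Fin (2 ^ n)) : ℕ) / 2) := by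
  have hw := w.1.2
  simp only [Matrix.mulVec, dotProduct, parentMatrix, Matrix.of_apply, sub_mul,
    Finset.sum_sub_distrib]
  congr 1
  · simp
  · rw [sum_fin_ne_zero (2 ^ n) fun i =>
      (if ((w : Fin (2 ^ n)) : ℕ) / 2 = i then (1 : ℤ) else 0) * f i]
    simp only [ite_mul, one_mul, zero_mul, Finset.sum_ite_eq, Finset.mem_Ico]
    split_ifs with h
    · rfl
    · rw [show ((w : Fin (2 ^ n)) : ℕ) / 2 = 0 by omega, hf]

theorem vecMul_parentMatrix (n : ℕ) (f : ℕ → ℤ) (u : {v : Fin (2 ^ n) // v ≠ 0}) :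
    Matrix.vecMul (fun v : {v : Fin (2 ^ n) // v ≠ 0} => f (v : Fin (2 ^ n))) (parentMatrix n) u =
      f (u : Fin (2 ^ n)) - (if 2 * ((u : Fin (2 ^ n)) : ℕ) < 2 ^ n then
        f (2 * ((u : Fin (2 ^ n)) : ℕ)) + f (2 * ((u : Fin (2 ^ n)) : ℕ) + 1) else 0) := by
  have hu := Fin.val_pos_of_subtype_ne_zero u
  simp only [Matrix.vecMul, dotProduct, parentMatrix, Matrix.of_apply, mul_sub,
    Finset.sum_sub_distrib]
  congr 1
  · simp
  · rw [sum_fin_ne_zero (2 ^ n) fun i =>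
      f i * (if i / 2 = ((u : Fin (2 ^ n)) : ℕ) then (1 : ℤ) else 0)]
    simp only [mul_ite, mul_one, mul_zero]
    rw [← Finset.sum_filter]
    generalize ((u : Fin (2 ^ n)) : ℕ) = a at *
    split_ifs with h
    · have hn : n ≠ 0 := by
        rintro rfl
        omega
      have heven : 2 ∣ 2 ^ n := dvd_pow_self 2 hn
      rw [show (Finset.Ico 1 (2 ^ n)).filter (fun i => i / 2 = a) = {2 * a, 2 * a + 1} by
        ext i
        simp only [Finset.mem_filter, Finset.mem_Ico, Finset.mem_insert, Finset.mem_singleton]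
        omega]
      rw [Finset.sum_pair (by omega)]
    · rw [Finset.filter_false_of_mem, Finset.sum_empty]
      intro i hi
      rw [Finset.mem_Ico] at hi
      omega

theorem vecMul_binaryTreeWeight (n : ℕ) :
    Matrix.vecMul (fun v : {v : Fin (2 ^ n) // v ≠ 0} =>
      (binaryTreeWeight n (Nat.size (v : Fin (2 ^ n))) : ℤ))
        ((parentMatrix n).transpose * parentMatrix n) = 1 := by
  have hw : ∀ j ≤ n, (binaryTreeWeight n j : ℤ) = 2 ^ (n + 1) - 2 ^ (n - j + 1) - j := by
    intro j hj
    have := binaryTreeWeight_add hj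
    zify at this
    linarith
  have h1 : (parentMatrix n).mulVec
      (fun v => (binaryTreeWeight n (Nat.size (v : Fin (2 ^ n))) : ℤ)) =
      fun v : {v : Fin (2 ^ n) // v ≠ 0} => 2 ^ (n - Nat.size (v : Fin (2 ^ n)) + 1) - 1 := by
    ext w
    have hw0 := Fin.val_pos_of_subtype_ne_zero w
    have hwn : Nat.size ((w : Fin (2 ^ n)) : ℕ) ≤ n := Nat.size_le.mpr w.1.2
    rw [parentMatrix_mulVec n (fun i => (binaryTreeWeight n (Nat.size i) : ℤ))
      (by simp [binaryTreeWeight])]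
    have hs := Nat.size_eq_size_div_two_add_one hw0.ne'
    rw [hw _ hwn, hw _ (by omega), hs]
    obtain ⟨k, hk⟩ := Nat.exists_eq_add_of_le hwn
    rw [show n - (Nat.size (((w : Fin (2 ^ n)) : ℕ) / 2) + 1) + 1 = k + 1 by omega,
      show n - Nat.size (((w : Fin (2 ^ n)) : ℕ) / 2) + 1 = k + 2 by omega]
    push_cast
    ring
  rw [← Matrix.vecMul_vecMul, Matrix.vecMul_transpose, h1]
  ext u
  have hu0 := Fin.val_pos_of_subtype_ne_zero u
  have hun : Nat.size ((u : Fin (2 ^ n)) : ℕ) ≤ n := Nat.size_le.mpr u.1.2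
  rw [vecMul_parentMatrix n (fun i => 2 ^ (n - Nat.size i + 1) - 1), Pi.one_apply]
  generalize ((u : Fin (2 ^ n)) : ℕ) = a at *
  have h2 := Nat.size_eq_size_div_two_add_one (v := 2 * a) (by omega)
  have h3 := Nat.size_eq_size_div_two_add_one (v := 2 * a + 1) (by omega)
  rw [show 2 * a / 2 = a by omega] at h2
  rw [show (2 * a + 1) / 2 = a by omega] at h3
  simp only [h2, h3]
  split_ifs with h
  · have h4 := Nat.size_le.mpr h
    obtain ⟨k, hk⟩ := Nat.exists_eq_add_of_le h4
    rw [show n - Nat.size a + 1 = k + 2 by omega, show n - (Nat.size a + 1) + 1 = k + 1 by omega]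
    ring
  · have h4 : n < Nat.size (2 * a) := Nat.lt_size.mpr (by omega)
    rw [show n - Nat.size a + 1 = 1 by omega]
    norm_num

theorem mainTheorem4 (n : ℕ) (hn : 1 ≤ n) :
    HasIntegerPointSeries (binaryTreeCone n) ∧
    integerPointSeries (binaryTreeCone n) =
      (∏ j ∈ Finset.Icc 1 n,
        (1 - (PowerSeries.X : PowerSeries ℚ) ^
          (j * (2 ^ (n - j + 1) - 1) +
            ∑ i ∈ Finset.Icc 1 (j - 1), (j - i) * 2 ^ (n - (j - i)))) ^ (2 ^ (j - 1)))⁻¹ ∧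
    integerPointSeries (binaryTreeCone n) =
      (∏ j ∈ Finset.Icc 1 n,
        (1 - (PowerSeries.X : PowerSeries ℚ) ^
          (2 ^ (n - j + 1) * (2 ^ j - 1) - j)) ^ (2 ^ (j - 1)))⁻¹ := by
  have hdet : IsUnit ((parentMatrix n).transpose * parentMatrix n).det := by
    simp [Matrix.det_mul, det_parentMatrix]
  have hpos : ∀ v : {v : Fin (2 ^ n) // v ≠ 0},
      0 < binaryTreeWeight n (Nat.size (v : Fin (2 ^ n))) := fun v =>
    binaryTreeWeight_pos (Nat.size_pos.mpr (Fin.val_pos_of_subtype_ne_zero v))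
      (Nat.size_le.mpr v.1.2)
  have hvec := vecMul_binaryTreeWeight n
  have hmain : integerPointSeries (binaryTreeCone n) =
      (∏ j ∈ Finset.Icc 1 n,
        (1 - (PowerSeries.X : PowerSeries ℚ) ^ binaryTreeWeight n j) ^ (2 ^ (j - 1)))⁻¹ := by
    rw [binaryTreeCone, laplacianMinor_leafedBinaryTree,
      integerPointSeries_matrixCone hdet hpos hvec,
      prod_fin_ne_zero (2 ^ n) fun i =>
        1 - (PowerSeries.X : PowerSeries ℚ) ^ binaryTreeWeight n (Nat.size i),
      prod_Ico_size n fun j => 1 - (PowerSeries.X : PowerSeries ℚ) ^ binaryTreeWeight n j]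
  refine ⟨?_, ?_, hmain⟩
  · rw [binaryTreeCone, laplacianMinor_leafedBinaryTree]
    exact hasIntegerPointSeries_matrixCone hdet hpos hvec
  · rw [hmain]
    congr 1
    refine Finset.prod_congr rfl fun j hj => ?_
    obtain ⟨h1, h2⟩ := Finset.mem_Icc.mp hj
    rw [binaryTreeWeight_eq_sum h1 h2]
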